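/- Let $L\ge 1$ and let $\omega_L$ denote the volume of the unit ball of $\mathbb{R}^L$ ($\omega_0=1$). For a (full-rank) lattice $\Lambda_s\subset\mathbb{R}^L$ with fundamental regions of volume $\nu_s$, a point $\lambda_0\in\Lambda_s$ and $r\in\mathbb R$, let $T_{\Lambda_s,\lambda_0}(r)$ be the number of 3-tuples $(\lambda_0,\lambda_1,\lambda_2)\in\Lambda_s^3$ with first coordinate $\lambda_0$ and with $\|\lambda_i-\lambda_j\|\le r$ for all $i,j\in\{0,1,2\}$; thus $\lambda_1,\lambda_2$ lie in the ball $\tilde V$ of radius $r$ centred at $\lambda_0$. Say that $\tilde V$ yields exactly $N$ admissible 3-tuples if $T_{\Lambda_s,\lambda_0}(r)\ge N$ and $T_{\Lambda_s,\lambda_0}(r')\le N$ for every $r'<r$ (this holds if $T_{\Lambda_s,\lambda_0}(r)=N$, and also for the least $r$ with $T_{\Lambda_s,\lambda_0}(r)\ge N$, as the integer-valued count may jump over $N$). Let $\bar r=(\nu_s\sqrt N/\omega_L)^{1/L}$ be the radius of the ball of volume $\nu_s\sqrt N$, the lower bound for the volume of $\tilde V$. The dimensionless expansion factor for $K=3$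 is the number $\psi_L$ such that, for every lattice $\Lambda\subset\mathbb{R}^L$, as $N\to\infty$, $$\frac{r}{\bar r}\longrightarrow\psi_L$$ uniformly over all lattices $\Lambda_s$ geometrically similar to $\Lambda$ (that is, $\Lambda_s=cU\Lambda$ with $c>0$ and $U$ orthogonal), all $\lambda_0\in\Lambda_s$, and all radii $r$ for which $\tilde V$ yields exactly $N$ admissible 3-tuples (such radii being required to exist for all large $N$). **Theorem.** For $K=3$ and every odd $L\ge 1$, the dimensionless expansion factor exists, is unique, and is given by $$\psi_L=\left(\frac{\omega_L}{\omega_{L-1}}\right)^{\frac1{2L}}\left(\frac{L+1}{2L}\right)^{\frac1{2L}}\beta_L^{-\frac1{2L}},$$ where $$\beta_L=\sum_{n=0}^{\frac{L+1}2}\binom{\frac{L+1}2}{n}2^{\frac{L+1}2-n}(-1)^n\sum_{k=0}^{\frac{L-1}2}\frac{\left(\frac{L+1}2\right)_k\left(\frac{1-L}2\right)_k}{\left(\frac{L+3}2\right)_k\,k!}\sum_{j=0}^k\binom kj\left(\frac12\right)^{k-j}(-1)^j\left(\frac14\right)^j\frac1{L+n+j}$$ and $(a)_0=1$, $(a)_k=a(a+1)\cdots(a+k-1)$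 for $k\ge1$ is the Pochhammer symbol. -/

import Mathlib

namespace MDLattice

noncomputable section

/-- Volume `ω_L` of the unit ball (solid sphere) of `ℝ^L`; `ω_0 = 1`. -/
def omega (L : ℕ) : ℝ :=
  MeasureTheory.volume.real (Metric.closedBall (0 : EuclideanSpace ℝ (Fin L)) 1)

/-- Number of `K`-tuples of points of `Λ` with first coordinate `p` and with all pairwise distances
at most `r`; in particular all coordinates lie in the closed ball of radius `r` around `p`. -/
def tupleCount (K : ℕ) [NeZero K] {L : ℕ} (Λ : Submodule ℤ (EuclideanSpace ℝ (Fin L)))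
    (p : EuclideanSpace ℝ (Fin L)) (r : ℝ) : ℕ :=
  Set.ncard {t : Fin K → EuclideanSpace ℝ (Fin L) |
    t 0 = p ∧ (∀ i, t i ∈ Λ) ∧ ∀ i j, ‖t i - t j‖ ≤ r}

/-- `r` is a radius at which the ball around `p` yields exactly `N` admissible `K`-tuples.
Since the count jumps as a function of the radius, it may skip the value `N`; so we ask that
`N` tuples are available at radius `r` and that no smaller radius yields more than `N` of them.
Every `r` with `tupleCount K Λ p r = N` qualifies, and so does the least radius with at
least `N` tuples. -/
def IsTupleRadius (K : ℕ) [NeZero K] {L : ℕ} (Λ : Submodule ℤ (EuclideanSpace ℝ (Fin L)))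
    (p : EuclideanSpace ℝ (Fin L)) (N : ℕ) (r : ℝ) : Prop :=
  N ≤ tupleCount K Λ p r ∧ ∀ r' < r, tupleCount K Λ p r' ≤ N

/-- Radius of the ball of `ℝ^L` of volume `ν_s N^{1/(K-1)}`, where `ν_s` is the volume
of a fundamental region of `Λ`. -/
def lowerRadius (K : ℕ) {L : ℕ} (Λ : Submodule ℤ (EuclideanSpace ℝ (Fin L))) (N : ℕ) : ℝ :=
  (ZLattice.covolume Λ * (N : ℝ) ^ (1 / ((K : ℝ) - 1)) / omega L) ^ (1 / (L : ℝ))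

/-- `Λ'` is obtained from `Λ` by scaling and rotating (possibly reflecting). -/
def GeometricallySimilar {L : ℕ} (Λ Λ' : Submodule ℤ (EuclideanSpace ℝ (Fin L))) : Prop :=
  ∃ (c : ℝ) (U : EuclideanSpace ℝ (Fin L) ≃ₗᵢ[ℝ] EuclideanSpace ℝ (Fin L)),
    0 < c ∧ (Λ' : Set (EuclideanSpace ℝ (Fin L))) = (fun x => c • U x) '' Λ

/-- `ψ` is the dimensionless expansion factor in dimension `L` for `K`-tuples: for every
lattice `Λ`, as `N → ∞` and uniformly over the lattices `Λs` geometrically similar to `Λ` (so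
whatever the scale of `Λs` is as `N` grows) and over the points `p` of `Λs`, the radius at which
the ball around `p` yields exactly `N` admissible `K`-tuples is asymptotically `ψ` times
the radius of the ball of volume `ν_s N^{1/(K-1)}`. -/
def IsExpansionFactor (K : ℕ) [NeZero K] (L : ℕ) (ψ : ℝ) : Prop :=
  ∀ (Λ : Submodule ℤ (EuclideanSpace ℝ (Fin L))) [DiscreteTopology Λ] [IsZLattice ℝ Λ],
    ∀ ε > 0, ∃ N₀ : ℕ, ∀ N ≥ N₀,
      ∀ (Λs : Submodule ℤ (EuclideanSpace ℝ (Fin L))) [DiscreteTopology Λs] [IsZLattice ℝ Λs],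
        GeometricallySimilar Λ Λs → ∀ p ∈ Λs,
          (∃ r, IsTupleRadius K Λs p N r) ∧
            ∀ r, IsTupleRadius K Λs p N r → |r / lowerRadius K Λs N - ψ| < ε

/-- Pochhammer symbol `(a)_k = a (a+1) ⋯ (a+k-1)`. -/
def poch (a : ℝ) (k : ℕ) : ℝ := (ascPochhammer ℝ k).eval a

/-- The triple sum `β_L` (used for odd `L`, where the divisions by `2` in the summation bounds
are exact). -/
def beta (L : ℕ) : ℝ :=
  ∑ n ∈ Finset.range ((L + 1) / 2 + 1),
    (((L + 1) / 2).choose n : ℝ) * 2 ^ ((L + 1) / 2 - n) * (-1) ^ n *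
      ∑ k ∈ Finset.range ((L - 1) / 2 + 1),
        poch (((L : ℝ) + 1) / 2) k * poch ((1 - (L : ℝ)) / 2) k /
            (poch (((L : ℝ) + 3) / 2) k * (k.factorial : ℝ)) *
          ∑ j ∈ Finset.range (k + 1),
            (k.choose j : ℝ) * (1 / 2) ^ (k - j) * (-1) ^ j * (1 / 4) ^ j *
              (1 / ((L : ℝ) + n + j))

end

end MDLattice

namespace MDLattice
open MeasureTheory Module Filter Topology Pointwise

/-! For base point `0`, admissible triples are the points of `Λ × Λ` in the dilate by `r` of one
convex body, `admissiblePairs L` in dimension `2L`. Counting lattice points in dilates gives a count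
asymptotic to `κ r ^ (2L)`, where `κ` is the volume `V` of the body divided by the squared covolume
(`tendsto_tupleCount`). A radius for `N` therefore satisfies `N / r ^ (2L) → κ`, even when the count
skips `N` (`isTupleRadius_density`). The covolume cancels against the one in the lower radius, so
the ratio tends to `(ω_L ^ 2 / V) ^ (1 / (2L))`. Uniformity costs nothing: a similarity followed by
a translation reduces every `Λs` and `p` to `Λ` and `0`, and scales both radii alike.

It remains to compute `V`. Fixing the first point at distance `t` from the origin leaves the second
in a lens, that is, two equal caps of the unit ball; polar coordinates then give a double integral
(`volume_admissiblePairs`). For `L = 2m + 1` the cap integrand `(1 - u ^ 2) ^ m` is a polynomial,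
and binomial expansions turn the integral into `beta L` (`beta_eq_integral`). -/

/-- The pairs of points which together with the origin form a triple of diameter at most `1`. -/
def admissiblePairs (L : ℕ) : Set (EuclideanSpace ℝ (Fin L) × EuclideanSpace ℝ (Fin L)) :=
  {q | ‖q.1‖ ≤ 1 ∧ ‖q.2‖ ≤ 1 ∧ ‖q.1 - q.2‖ ≤ 1}

/-! ### Triples as lattice points in a convex body -/

variable {L : ℕ}

lemma isClosed_admissiblePairs : IsClosed (admissiblePairs L) := by
  have h {f : EuclideanSpace ℝ (Fin L) × EuclideanSpace ℝ (Fin L) → EuclideanSpace ℝ (Fin L)}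
      (hf : Continuous f) : IsClosed {q | ‖f q‖ ≤ 1} := isClosed_le hf.norm continuous_const
  exact (h continuous_fst).inter ((h continuous_snd).inter (h (continuous_fst.sub continuous_snd)))

lemma convex_admissiblePairs : Convex ℝ (admissiblePairs L) := by
  let E := EuclideanSpace ℝ (Fin L)
  have h (f : E × E →ₗ[ℝ] E) : Convex ℝ {q | ‖f q‖ ≤ 1} := by
    have := (convex_closedBall (0 : E) 1).linear_preimage f
    simp only [Metric.closedBall, dist_zero_right] at this
    exact this
  exact (h (LinearMap.fst ℝ E E)).inter ((h (LinearMap.snd ℝ E E)).inter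
    (h (LinearMap.fst ℝ E E - LinearMap.snd ℝ E E)))

lemma isBounded_admissiblePairs : Bornology.IsBounded (admissiblePairs L) := by
  refine (Metric.isBounded_closedBall (x := 0) (r := 1)).subset fun q hq => ?_
  simpa [Prod.norm_def] using ⟨hq.1, hq.2.1⟩

/-- A basis of `E` induces coordinates on `E × E`. -/
noncomputable def pairEquiv {ι E : Type*} [Fintype ι] [NormedAddCommGroup E] [NormedSpace ℝ E]
    (B : Basis ι ℝ E) : (ι ⊕ ι → ℝ) ≃ₗ[ℝ] E × E :=
  (LinearEquiv.sumArrowLequivProdArrow ι ι ℝ ℝ).trans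
    (B.equivFun.symm.prodCongr B.equivFun.symm)

lemma volume_preimage_pairEquiv (Λ : Submodule ℤ (EuclideanSpace ℝ (Fin L)))
    [DiscreteTopology Λ] [IsZLattice ℝ Λ] {ι : Type*} [Fintype ι] (b : Basis ι ℤ Λ)
    {s : Set (EuclideanSpace ℝ (Fin L) × EuclideanSpace ℝ (Fin L))} (hs : MeasurableSet s) :
    volume (pairEquiv (b.ofZLatticeBasis ℝ Λ) ⁻¹' s) =
      volume s / ENNReal.ofReal (ZLattice.covolume Λ) ^ 2 := by
  set B := b.ofZLatticeBasis ℝ Λ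
  set v := ENNReal.ofReal (ZLattice.covolume Λ)
  have hv : v ≠ 0 := by simpa [v] using ZLattice.covolume_pos Λ
  have hv' : v ≠ ⊤ := ENNReal.ofReal_ne_top
  have hm : Measurable B.equivFun.symm :=
    B.equivFunL.symm.continuous.measurable
  have h1 : Measure.map B.equivFun.symm volume = v⁻¹ • volume := by
    ext t ht
    rw [Measure.map_apply hm ht, ← LinearEquiv.image_eq_preimage_symm,
      ZLattice.volume_image_eq_volume_div_covolume' Λ b ht.nullMeasurableSet]
    simp [ENNReal.div_eq_inv_mul, v]
  have h2 := volume_measurePreserving_sumPiEquivProdPi (fun _ : ι ⊕ ι => ℝ)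
  have h3 : pairEquiv B ⁻¹' s = MeasurableEquiv.sumPiEquivProdPi (fun _ : ι ⊕ ι => ℝ) ⁻¹'
      (Prod.map B.equivFun.symm B.equivFun.symm ⁻¹' s) := rfl
  rw [h3, h2.measure_preimage_equiv, Measure.volume_eq_prod,
    ← Measure.map_apply (hm.prodMap hm) hs, ← Measure.map_prod_map _ _ hm hm, h1]
  rw [Measure.prod_smul_left, Measure.prod_smul_right]
  simp only [Measure.smul_apply, smul_eq_mul, ← Measure.volume_eq_prod, ENNReal.div_eq_inv_mul,
    ← mul_assoc]
  rw [sq, ENNReal.mul_inv (Or.inl hv) (Or.inl hv')]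

/-- Coordinates in a lattice basis turn `Λ × Λ` into integer vectors. Dividing by `r` then fixes the
body and shrinks the lattice, the form needed for the asymptotic count. -/
lemma tupleCount_eq_card (Λ : Submodule ℤ (EuclideanSpace ℝ (Fin L)))
    [DiscreteTopology Λ] [IsZLattice ℝ Λ] {ι : Type*} [Fintype ι] (b : Basis ι ℤ Λ)
    {r : ℝ} (hr : 0 < r) :
    tupleCount 3 Λ 0 r = Nat.card ↑(pairEquiv (b.ofZLatticeBasis ℝ Λ) ⁻¹' admissiblePairs L ∩
      r⁻¹ • (Submodule.span ℤ (Set.range (Pi.basisFun ℝ (ι ⊕ ι))) : Set (ι ⊕ ι → ℝ))) := by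
  set B := b.ofZLatticeBasis ℝ Λ
  have hΛ (x) : x ∈ Λ ↔ ∀ i, B.equivFun x i ∈ Set.range (algebraMap ℤ ℝ) := by
    conv_lhs => rw [← b.ofZLatticeBasis_span ℝ]
    rw [Basis.mem_span_iff_repr_mem]
    rfl
  let f : (ι ⊕ ι → ℝ) → (Fin 3 → EuclideanSpace ℝ (Fin L)) :=
    fun v => ![0, r • (pairEquiv B v).1, r • (pairEquiv B v).2]
  have hf : Function.Injective f := by
    intro v w h
    have h1 := congrFun h 1
    have h2 := congrFun h 2
    simp only [f, Matrix.cons_val] at h1 h2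
    exact (pairEquiv B).injective (Prod.ext (smul_right_injective _ hr.ne' h1)
      (smul_right_injective _ hr.ne' h2))
  have hmem (v : ι ⊕ ι → ℝ) : v ∈ r⁻¹ • (Submodule.span ℤ (Set.range (Pi.basisFun ℝ (ι ⊕ ι))) :
      Set (ι ⊕ ι → ℝ)) ↔ r • (pairEquiv B v).1 ∈ Λ ∧ r • (pairEquiv B v).2 ∈ Λ := by
    rw [Set.mem_inv_smul_set_iff₀ hr.ne', SetLike.mem_coe, Basis.mem_span_iff_repr_mem, hΛ, hΛ]
    simp only [map_smul, Sum.forall]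
    have h1 : B.equivFun (pairEquiv B v).1 = fun i => v (.inl i) :=
      B.equivFun.apply_symm_apply _
    have h2 : B.equivFun (pairEquiv B v).2 = fun i => v (.inr i) :=
      B.equivFun.apply_symm_apply _
    rw [h1, h2]
    simp
  have hn (x : EuclideanSpace ℝ (Fin L)) : ‖r • x‖ ≤ r ↔ ‖x‖ ≤ 1 := by
    rw [norm_smul, Real.norm_of_nonneg hr.le]
    exact ⟨fun h => by nlinarith, fun h => by nlinarith⟩
  rw [tupleCount, Nat.card_coe_set_eq, ← Set.ncard_image_of_injective _ hf]
  congr 1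
  ext t
  simp only [Set.mem_ofPred_eq, Set.mem_image, Set.mem_inter_iff, hmem, Set.mem_preimage,
    admissiblePairs]
  constructor
  · rintro ⟨h0, hl, hd⟩
    refine ⟨(pairEquiv B).symm (r⁻¹ • t 1, r⁻¹ • t 2), ?_, ?_⟩
    · simp only [LinearEquiv.apply_symm_apply, smul_inv_smul₀ hr.ne', hl, and_self, and_true]
      rw [← hn, ← hn, ← hn, smul_sub]
      simp only [smul_inv_smul₀ hr.ne', hd, and_true]
      have h1 := hd 1 0
      have h2 := hd 2 0
      rw [h0, sub_zero] at h1 h2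
      exact ⟨h1, h2⟩
    · ext i : 1
      fin_cases i <;> simp [f, h0, smul_inv_smul₀ hr.ne']
  · rintro ⟨v, ⟨⟨h1, h2, h3⟩, h4, h5⟩, rfl⟩
    rw [← hn] at h1 h2 h3
    rw [smul_sub] at h3
    refine ⟨rfl, fun i => ?_, fun i j => ?_⟩
    · fin_cases i <;> simp [f, h4, h5]
    · fin_cases i <;> fin_cases j <;>
        simp only [f, Fin.zero_eta, Fin.mk_one, Fin.reduceFinMk, Matrix.cons_val, sub_self,
          norm_zero, zero_sub, sub_zero, norm_neg, hr.le, h1, h2, h3]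
      rwa [norm_sub_rev]

theorem tendsto_tupleCount (Λ : Submodule ℤ (EuclideanSpace ℝ (Fin L)))
    [DiscreteTopology Λ] [IsZLattice ℝ Λ] :
    Tendsto (fun r : ℝ => (tupleCount 3 Λ 0 r : ℝ) / r ^ (2 * L)) atTop
      (𝓝 (volume.real (admissiblePairs L) / ZLattice.covolume Λ ^ 2)) := by
  let b := Free.chooseBasis ℤ Λ
  set B := b.ofZLatticeBasis ℝ Λ
  have hcard : Fintype.card (Free.ChooseBasisIndex ℤ Λ) = L := by
    rw [← finrank_eq_card_basis B, finrank_euclideanSpace_fin]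
  have hcont : Continuous (pairEquiv B) :=
    LinearMap.continuous_of_finiteDimensional (pairEquiv B).toLinearMap
  have hconv : Convex ℝ (pairEquiv B ⁻¹' admissiblePairs L) :=
    convex_admissiblePairs.linear_preimage (pairEquiv B).toLinearMap
  have hbdd : Bornology.IsBounded (pairEquiv B ⁻¹' admissiblePairs L) := by
    rw [← LinearEquiv.image_symm_eq_preimage]
    exact ((LinearMap.toContinuousLinearMap (pairEquiv B).symm.toLinearMap).lipschitz.isBounded_image
      isBounded_admissiblePairs)
  have hzero : (0 : Free.ChooseBasisIndex ℤ Λ ⊕ Free.ChooseBasisIndex ℤ Λ → ℝ) ∈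
      pairEquiv B ⁻¹' admissiblePairs L := by
    simp [admissiblePairs]
  have key := tendsto_card_div_pow_atTop_volume' (pairEquiv B ⁻¹' admissiblePairs L) hbdd
    (isClosed_admissiblePairs.preimage hcont).measurableSet (hconv.addHaar_frontier volume) ?_
  · have hv : volume.real (pairEquiv B ⁻¹' admissiblePairs L) =
        volume.real (admissiblePairs L) / ZLattice.covolume Λ ^ 2 := by
      rw [Measure.real, volume_preimage_pairEquiv Λ b isClosed_admissiblePairs.measurableSet,
        ENNReal.toReal_div, ENNReal.toReal_pow, ENNReal.toReal_ofReal (ZLattice.covolume_pos Λ volume).le]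
      rfl
    rw [hv] at key
    refine key.congr' ?_
    filter_upwards [eventually_gt_atTop 0] with r hr
    rw [tupleCount_eq_card Λ b hr, Fintype.card_sum, hcard, two_mul]
  -- The dilates increase with the factor, since a convex set containing the origin is star-shaped
  -- about it.
  · rintro x y hx hxy _ ⟨v, hv, rfl⟩
    have hy := hx.trans_le hxy
    refine ⟨(x / y) • v, hconv.smul_mem_of_zero_mem hzero hv ⟨by positivity, ?_⟩, ?_⟩
    · exact (div_le_one hy).2 hxy
    · simp only [smul_smul]
      rw [mul_div_cancel₀ _ hy.ne']

/-! ### The volume of the body of admissible pairs -/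

lemma omega_pos (L : ℕ) : 0 < omega L :=
  ENNReal.toReal_pos (Metric.measure_closedBall_pos _ _ one_pos).ne' measure_closedBall_lt_top.ne

lemma volume_setOf_sum_sq_le (m : ℕ) {ρ : ℝ} (hρ : 0 ≤ ρ) :
    volume {w : Fin (2 * m) → ℝ | ∑ i, w i ^ 2 ≤ ρ} = ENNReal.ofReal (omega (2 * m) * ρ ^ m) := by
  have h : {w : Fin (2 * m) → ℝ | ∑ i, w i ^ 2 ≤ ρ} =
      WithLp.toLp 2 ⁻¹' Metric.closedBall (0 : EuclideanSpace ℝ (Fin (2 * m))) (√ρ) := by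
    ext w
    simp [EuclideanSpace.norm_eq, Real.sqrt_le_sqrt_iff hρ]
  rw [h, (PiLp.volume_preserving_toLp _).measure_preimage
    Metric.isClosed_closedBall.measurableSet.nullMeasurableSet,
    Measure.addHaar_closedBall' _ _ (Real.sqrt_nonneg _), finrank_euclideanSpace_fin, pow_mul,
    Real.sq_sqrt hρ, mul_comm (omega _), ENNReal.ofReal_mul (by positivity), omega,
    ofReal_measureReal measure_closedBall_lt_top.ne]

/-- The intersection of two unit balls whose centres are `t` apart on the first axis. -/
def coordLens (m : ℕ) (t : ℝ) : Set (ℝ × (Fin (2 * m) → ℝ)) :=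
  {q : ℝ × (Fin (2 * m) → ℝ) | q.1 ^ 2 + ∑ i, q.2 i ^ 2 ≤ 1 ∧
    (q.1 - t) ^ 2 + ∑ i, q.2 i ^ 2 ≤ 1}

lemma isClosed_coordLens (m : ℕ) (t : ℝ) : IsClosed (coordLens m t) := by
  have h {f : ℝ × (Fin (2 * m) → ℝ) → ℝ} (hf : Continuous f) : IsClosed {q | f q ≤ 1} :=
    isClosed_le hf continuous_const
  exact (h (f := fun q => q.1 ^ 2 + ∑ i, q.2 i ^ 2) (by fun_prop)).inter
    (h (f := fun q => (q.1 - t) ^ 2 + ∑ i, q.2 i ^ 2) (by fun_prop))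

/-- The slice at height `u` is a ball whose squared radius is the smaller of those from the two unit
balls. The minimum changes branch at `u = t / 2`, which cuts the lens into two congruent caps. -/
lemma volume_lens_coord (m : ℕ) {t : ℝ} (ht0 : 0 ≤ t) (ht1 : t ≤ 1) :
    volume (coordLens m t) =
    ENNReal.ofReal (2 * omega (2 * m) * ∫ u in (t / 2)..1, (1 - u ^ 2) ^ m) := by
  set ρ : ℝ → ℝ := fun u => min (1 - u ^ 2) (1 - (u - t) ^ 2)
  have hρc : Continuous ρ := by fun_prop
  have hρ (u) : 0 ≤ ρ u ↔ u ∈ Set.Icc (t - 1) 1 := by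
    simp only [ρ, le_min_iff, Set.mem_Icc]
    constructor
    · rintro ⟨h1, h2⟩
      constructor <;> nlinarith
    · rintro ⟨h1, h2⟩
      constructor <;> nlinarith
  have hslice (u : ℝ) : volume (Prod.mk u ⁻¹' coordLens m t) =
      (Set.Icc (t - 1) 1).indicator (fun u => ENNReal.ofReal (omega (2 * m) * ρ u ^ m)) u := by
    have h : Prod.mk u ⁻¹' coordLens m t =
        {w | ∑ i, w i ^ 2 ≤ ρ u} := by
      ext w
      simp only [Set.mem_preimage, Set.mem_ofPred_eq, ρ, coordLens, le_min_iff, le_sub_iff_add_le']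
    rw [h]
    by_cases hu : u ∈ Set.Icc (t - 1) 1
    · rw [Set.indicator_of_mem hu, volume_setOf_sum_sq_le m ((hρ u).2 hu)]
    · rw [Set.indicator_of_notMem hu]
      convert measure_empty (μ := volume)
      ext w
      simp only [Set.mem_ofPred_eq, Set.mem_empty_iff_false, iff_false, not_le]
      exact (not_le.1 (mt (hρ u).1 hu)).trans_le (Finset.sum_nonneg fun i _ => sq_nonneg _)
  rw [Measure.volume_eq_prod, Measure.prod_apply (isClosed_coordLens m _).measurableSet]
  simp_rw [hslice]
  rw [lintegral_indicator measurableSet_Icc, ← ofReal_integral_eq_lintegral_ofReal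
    (ContinuousOn.integrableOn_Icc (by fun_prop))
    ((ae_restrict_mem measurableSet_Icc).mono fun u hu =>
      mul_nonneg (omega_pos _).le (pow_nonneg ((hρ u).2 hu) _)), integral_const_mul,
    integral_Icc_eq_integral_Ioc, ← intervalIntegral.integral_of_le (by linarith),
    ← intervalIntegral.integral_add_adjacent_intervals (b := t / 2)
      (Continuous.intervalIntegrable (by fun_prop) _ _)
      (Continuous.intervalIntegrable (by fun_prop) _ _)]
  have h1 : ∫ u in (t / 2)..1, ρ u ^ m = ∫ u in (t / 2)..1, (1 - u ^ 2) ^ m := by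
    refine intervalIntegral.integral_congr fun u hu => ?_
    rw [Set.uIcc_of_le (by linarith), Set.mem_Icc] at hu
    simp only [ρ]
    rw [min_eq_left (by nlinarith)]
  -- The reflection `u ↦ t - u` swaps the two balls and hence the two caps.
  have h2 : ∫ u in (t - 1)..(t / 2), ρ u ^ m = ∫ u in (t / 2)..1, (1 - u ^ 2) ^ m := by
    have := intervalIntegral.integral_comp_sub_left (a := t / 2) (b := 1) (fun u => ρ u ^ m) t
    rw [sub_half] at this
    rw [← this, ← h1]
    congr! 3 with u
    simp only [ρ]
    rw [min_comm]
    ring_nf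
  rw [h1, h2]
  congr 1
  ring

lemma exists_orthonormalBasis_repr_eq_single (n : ℕ) (x : EuclideanSpace ℝ (Fin (n + 1))) :
    ∃ b : OrthonormalBasis (Fin (n + 1)) ℝ (EuclideanSpace ℝ (Fin (n + 1))),
      b.repr x = EuclideanSpace.single 0 ‖x‖ := by
  rcases eq_or_ne x 0 with rfl | hx
  · exact ⟨EuclideanSpace.basisFun _ _, by ext; simp⟩
  obtain ⟨b, hb⟩ := Orthonormal.exists_orthonormalBasis_extension_of_card_eq (𝕜 := ℝ)
    (E := EuclideanSpace ℝ (Fin (n + 1))) (ι := Fin (n + 1)) (by simp)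
    (v := fun _ => ‖x‖⁻¹ • x) (s := {0}) (by
      rw [orthonormal_iff_ite]
      rintro ⟨i, rfl⟩ ⟨j, rfl⟩
      simp [norm_smul, norm_ne_zero_iff.2 hx])
  refine ⟨b, ?_⟩
  have h0 : x = ‖x‖ • b 0 := by
    rw [hb 0 rfl, smul_inv_smul₀ (norm_ne_zero_iff.2 hx)]
  conv_lhs => rw [h0]
  rw [map_smul, b.repr_self]
  ext i
  simp

lemma volume_lens (m : ℕ) {x : EuclideanSpace ℝ (Fin (2 * m + 1))} (hx : ‖x‖ ≤ 1) :
    volume {y : EuclideanSpace ℝ (Fin (2 * m + 1)) | ‖y‖ ≤ 1 ∧ ‖x - y‖ ≤ 1} =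
    ENNReal.ofReal (2 * omega (2 * m) * ∫ u in (‖x‖ / 2)..1, (1 - u ^ 2) ^ m) := by
  obtain ⟨b, hb⟩ := exists_orthonormalBasis_repr_eq_single (2 * m) x
  rw [← volume_lens_coord m (norm_nonneg x) hx]
  set t := ‖x‖ with ht
  have hp := (volume_preserving_piFinSuccAbove (fun _ : Fin (2 * m + 1) => ℝ) 0).comp
    ((PiLp.volume_preserving_ofLp (Fin (2 * m + 1))).comp b.measurePreserving_repr)
  rw [← hp.measure_preimage (isClosed_coordLens m _).measurableSet.nullMeasurableSet]
  congr 1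
  ext y
  have hn (z : EuclideanSpace ℝ (Fin (2 * m + 1))) :
      ‖z‖ ≤ 1 ↔ z 0 ^ 2 + ∑ i : Fin (2 * m), z i.succ ^ 2 ≤ 1 := by
    rw [EuclideanSpace.norm_eq, Real.sqrt_le_one, Fin.sum_univ_succ]
    simp
  rw [Set.mem_ofPred_eq, ← b.repr.norm_map y, ← b.repr.norm_map (x - y), map_sub, hb, hn, hn]
  simp [coordLens, MeasurableEquiv.piFinSuccAbove, Fin.tail, sub_sq_comm t]

/-- The slice over `x` is a lens depending only on `‖x‖`, and is empty for `‖x‖ > 1`. Fubini and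
polar coordinates apply. -/
theorem volume_admissiblePairs (m : ℕ) :
    volume.real (admissiblePairs (2 * m + 1)) =
      (2 * m + 1) * omega (2 * m + 1) * (2 * omega (2 * m)) *
        ∫ t in (0 : ℝ)..1, t ^ (2 * m) * ∫ u in (t / 2)..1, (1 - u ^ 2) ^ m := by
  set f : ℝ → ℝ := fun t => 2 * omega (2 * m) * ∫ u in (t / 2)..1, (1 - u ^ 2) ^ m
  have hfc : Continuous f := by
    have : Continuous fun t : ℝ => ∫ u in (1 : ℝ)..(t / 2), (1 - u ^ 2) ^ m :=
      (intervalIntegral.continuous_primitive (fun a b =>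
        Continuous.intervalIntegrable (by fun_prop) a b) 1).comp (by fun_prop)
    simp only [f, intervalIntegral.integral_symm (1 : ℝ)]
    fun_prop
  have hf0 {t : ℝ} (h0 : 0 ≤ t) (ht : t ≤ 1) : 0 ≤ f t := by
    refine mul_nonneg (by linarith [omega_pos (2 * m)])
      (intervalIntegral.integral_nonneg (by linarith) fun u hu => pow_nonneg ?_ _)
    nlinarith [hu.1, hu.2]
  set h : ℝ → ℝ := (Set.Icc 0 1).indicator f
  have hslice (x : EuclideanSpace ℝ (Fin (2 * m + 1))) :
      volume (Prod.mk x ⁻¹' admissiblePairs (2 * m + 1)) = ENNReal.ofReal (h ‖x‖) := by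
    by_cases hx : ‖x‖ ≤ 1
    · simp only [h]
      rw [Set.indicator_of_mem (Set.mem_Icc.2 ⟨norm_nonneg x, hx⟩), ← volume_lens m hx]
      simp [admissiblePairs, hx]
    · simp only [h]
      rw [Set.indicator_of_notMem (fun h' => hx h'.2)]
      simp [admissiblePairs, hx]
  rw [Measure.real, Measure.volume_eq_prod,
    Measure.prod_apply isClosed_admissiblePairs.measurableSet]
  simp_rw [hslice]
  rw [← integral_eq_lintegral_of_nonneg_ae]
  · rw [integral_fun_norm_addHaar volume h, finrank_euclideanSpace_fin]
    have hr : volume.real (Metric.ball (0 : EuclideanSpace ℝ (Fin (2 * m + 1))) 1) =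
        omega (2 * m + 1) := by
      rw [omega, Measure.real, Measure.real, Measure.addHaar_closedBall_eq_addHaar_ball]
    have hint : ∫ y in Set.Ioi (0 : ℝ), y ^ (2 * m + 1 - 1) • h y =
        2 * omega (2 * m) * ∫ t in (0 : ℝ)..1, t ^ (2 * m) * ∫ u in (t / 2)..1, (1 - u ^ 2) ^ m := by
      have h1 (y : ℝ) (hy : y ∈ Set.Ioi (0 : ℝ)) : y ^ (2 * m + 1 - 1) • h y =
          (Set.Ioc 0 1).indicator (fun t => t ^ (2 * m) * f t) y := by
        simp only [h, Set.indicator, Set.mem_Icc, Set.mem_Ioc, (Set.mem_Ioi.1 hy).le,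
          Set.mem_Ioi.1 hy, true_and, smul_eq_mul, add_tsub_cancel_right, mul_ite, mul_zero]
      rw [setIntegral_congr_fun measurableSet_Ioi h1, setIntegral_indicator measurableSet_Ioc,
        Set.inter_eq_right.2 Set.Ioc_subset_Ioi_self, ← intervalIntegral.integral_of_le zero_le_one,
        ← intervalIntegral.integral_const_mul]
      refine intervalIntegral.integral_congr fun t _ => ?_
      simp only [f]
      ring
    rw [hr, hint, nsmul_eq_mul, smul_eq_mul]
    push_cast
    ring
  · refine Eventually.of_forall fun x => Set.indicator_nonneg (fun t ht => hf0 ht.1 ht.2) _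
  · exact (((hfc.measurable.indicator measurableSet_Icc).comp measurable_norm)).aestronglyMeasurable

/-! ### The triple sum as an integral -/

/-- The quotient of the symbols at `m + 1` and `m + 2` telescopes, and the symbol at `-m` is a
signed falling factorial. -/
lemma poch_mul_poch_div (m k : ℕ) :
    poch (m + 1) k * poch (-m) k / (poch (m + 2) k * (k.factorial : ℝ)) =
      (m + 1) / (m + 1 + k) * ((-1) ^ k * (m.choose k : ℝ)) := by
  have h1 : poch (-m) k = (-1) ^ k * (k.factorial * m.choose k : ℝ) := by
    rw [poch, ascPochhammer_eval_neg_eq_descPochhammer, descPochhammer_eval_eq_descFactorial,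
      Nat.descFactorial_eq_factorial_mul_choose]
    push_cast
    rfl
  have h2 : poch (m + 1) k * (m + 1 + k) = (m + 1) * poch (m + 2) k := by
    rw [poch, poch, ← ascPochhammer_succ_eval, ascPochhammer_succ_left]
    simp [Polynomial.eval_comp]
    ring_nf
    simp
  have h3 : 0 < poch (m + 2) k := ascPochhammer_pos _ _ (by positivity)
  have h4 : (0 : ℝ) < m + 1 + k := by positivity
  have h5 : (k.factorial : ℝ) ≠ 0 := by positivity
  rw [h1, div_mul_eq_mul_div, div_eq_div_iff (by positivity) h4.ne']
  linear_combination (-1) ^ k * (k.factorial * m.choose k : ℝ) * h2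

/-- With `x = (1 - u) / 2` one has `1 - u ^ 2 = 4 x (1 - x)`. Expanding `(1 - x) ^ m` and
integrating termwise gives the antiderivative `F`, which vanishes at `u = 1`. At `u = t / 2`, `4 x =
2 - t` explains the prefactor. -/
lemma integral_cap (m : ℕ) (t : ℝ) :
    (2 * m + 2) * ∫ u in (t / 2)..1, (1 - u ^ 2) ^ m =
      (2 - t) ^ (m + 1) * ∑ k ∈ Finset.range (m + 1),
        (m + 1) / (m + 1 + k) * ((-1) ^ k * (m.choose k : ℝ)) * (1 / 2 - t / 4) ^ k := by
  set F : ℝ → ℝ := fun u => -(2 * 4 ^ m) * ∑ k ∈ Finset.range (m + 1),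
    (-1) ^ k * (m.choose k : ℝ) * (((1 - u) / 2) ^ (m + k + 1) / (m + k + 1))
  have hF (u : ℝ) : HasDerivAt F ((1 - u ^ 2) ^ m) u := by
    have hx : HasDerivAt (fun u : ℝ => (1 - u) / 2) (-1 / 2) u := by
      simpa using ((hasDerivAt_id u).const_sub 1).div_const 2
    have hs := HasDerivAt.fun_sum (u := Finset.range (m + 1)) fun k _ =>
      ((hx.fun_pow (m + k + 1)).div_const ((m : ℝ) + k + 1)).const_mul ((-1) ^ k * (m.choose k : ℝ))
    refine (hs.const_mul (-(2 * 4 ^ m))).congr_deriv ?_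
    symm
    have h1 : (1 - u ^ 2) ^ m = 4 ^ m * (((1 - u) / 2) ^ m * (-((1 - u) / 2) + 1) ^ m) := by
      rw [← mul_pow, ← mul_pow]
      ring
    rw [h1, add_pow, Finset.mul_sum, Finset.mul_sum, Finset.mul_sum]
    refine Finset.sum_congr rfl fun k _ => ?_
    have h2 : (m : ℝ) + k + 1 ≠ 0 := by positivity
    rw [neg_pow ((1 - u) / 2)]
    push_cast
    field_simp
    simp only [one_pow, mul_one]
    ring
  rw [intervalIntegral.integral_eq_sub_of_hasDerivAt (fun u _ => hF u)
    (Continuous.intervalIntegrable (by fun_prop) _ _)]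
  have h1 : F 1 = 0 := by simp [F]
  have h2 : (2 - t) ^ (m + 1) = 4 ^ (m + 1) * (1 / 2 - t / 4) ^ (m + 1) := by
    rw [← mul_pow]
    ring
  simp only [h1, F]
  rw [h2, zero_sub, neg_mul, neg_neg, Finset.mul_sum, Finset.mul_sum, Finset.mul_sum]
  refine Finset.sum_congr rfl fun k _ => ?_
  have h3 : (m : ℝ) + 1 + k ≠ 0 := by positivity
  have h4 : (m : ℝ) + k + 1 ≠ 0 := by positivity
  have h5 : (1 - t / 2) / 2 = 1 / 2 - t / 4 := by ring
  rw [h5, show m + k + 1 = m + 1 + k by ring, pow_add _ (m + 1) k,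
    show (m : ℝ) + k + 1 = m + 1 + k by ring]
  field_simp
  ring

/-- The index `n` expands `(2 - t) ^ (m + 1)`, `k` comes from the cap integral, and `j` expands `(1
/ 2 - t / 4) ^ k`. Integrating the resulting power of `t` gives `1 / (L + n + j)`. -/
theorem beta_eq_integral (m : ℕ) :
    beta (2 * m + 1) =
      (2 * m + 2) * ∫ t in (0 : ℝ)..1, t ^ (2 * m) * ∫ u in (t / 2)..1, (1 - u ^ 2) ^ m := by
  set c : ℕ → ℝ := fun k => (m + 1) / (m + 1 + k) * ((-1) ^ k * (m.choose k : ℝ))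
  have hpt (t : ℝ) : (2 * m + 2) * (t ^ (2 * m) * ∫ u in (t / 2)..1, (1 - u ^ 2) ^ m) =
      ∑ n ∈ Finset.range (m + 1 + 1), ∑ k ∈ Finset.range (m + 1), ∑ j ∈ Finset.range (k + 1),
        ((m + 1).choose n : ℝ) * 2 ^ (m + 1 - n) * (-1) ^ n * (c k *
          ((k.choose j : ℝ) * (1 / 2) ^ (k - j) * (-1) ^ j * (1 / 4) ^ j)) *
            t ^ (2 * m + n + j) := by
    rw [mul_left_comm, integral_cap, show 2 - t = -t + 2 by ring,
      show 1 / 2 - t / 4 = -(t * (1 / 4)) + 1 / 2 by ring, add_pow, Finset.sum_mul, Finset.mul_sum]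
    refine Finset.sum_congr rfl fun n _ => ?_
    rw [Finset.mul_sum, Finset.mul_sum]
    refine Finset.sum_congr rfl fun k _ => ?_
    rw [add_pow, Finset.mul_sum, Finset.mul_sum, Finset.mul_sum]
    refine Finset.sum_congr rfl fun j _ => ?_
    rw [neg_pow t, neg_pow (t * (1 / 4)), mul_pow, pow_add, pow_add]
    ring
  rw [← intervalIntegral.integral_const_mul]
  simp_rw [hpt]
  have e1 : (2 * m + 1 + 1) / 2 = m + 1 := by omega
  have e2 : (2 * m + 1 - 1) / 2 = m := by omega
  have e3 : (((2 * m + 1 : ℕ) : ℝ) + 1) / 2 = m + 1 := by push_cast; ring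
  have e4 : (1 - ((2 * m + 1 : ℕ) : ℝ)) / 2 = -m := by push_cast; ring
  have e5 : (((2 * m + 1 : ℕ) : ℝ) + 3) / 2 = m + 2 := by push_cast; ring
  rw [beta, e1, e2, e3, e4, e5, intervalIntegral.integral_finsetSum
    fun n _ => Continuous.intervalIntegrable (by fun_prop) _ _]
  refine Finset.sum_congr rfl fun n _ => ?_
  rw [intervalIntegral.integral_finsetSum
    fun n _ => Continuous.intervalIntegrable (by fun_prop) _ _, Finset.mul_sum]
  refine Finset.sum_congr rfl fun k _ => ?_
  rw [intervalIntegral.integral_finsetSum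
    fun n _ => Continuous.intervalIntegrable (by fun_prop) _ _, poch_mul_poch_div, Finset.mul_sum,
    Finset.mul_sum]
  refine Finset.sum_congr rfl fun j _ => ?_
  rw [intervalIntegral.integral_const_mul, integral_pow]
  simp only [c]
  push_cast
  simp only [one_pow, zero_pow (Nat.succ_ne_zero _), sub_zero]
  rw [show (2 * (m : ℝ) + 1 + n + j) = 2 * m + n + j + 1 by ring]
  ring

theorem volume_admissiblePairs_eq_beta (m : ℕ) :
    volume.real (admissiblePairs (2 * m + 1)) =
      omega (2 * m + 1) * omega (2 * m) * ((2 * m + 1) / (m + 1)) * beta (2 * m + 1) := by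
  rw [volume_admissiblePairs, beta_eq_integral]
  field_simp

lemma volume_admissiblePairs_pos (L : ℕ) : 0 < volume.real (admissiblePairs L) := by
  refine ENNReal.toReal_pos (fun h => ?_) isBounded_admissiblePairs.measure_lt_top.ne
  have h1 : Metric.ball (0 : EuclideanSpace ℝ (Fin L) × EuclideanSpace ℝ (Fin L)) (1 / 2) ⊆
      admissiblePairs L := by
    intro q hq
    rw [mem_ball_zero_iff, Prod.norm_def, max_lt_iff] at hq
    exact ⟨by linarith [hq.1], by linarith [hq.2], (norm_sub_le _ _).trans (by linarith)⟩
  exact (Metric.measure_ball_pos volume _ (by norm_num)).ne' (measure_mono_null h1 h)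

/-! ### Reduction to one lattice and the base point `0` -/

/-- The map `x ↦ c • U x + p` carries `Λ` onto `Λs` and `0` to `p`, and multiplies distances by `c`.
-/
lemma tupleCount_of_similar (K : ℕ) [NeZero K] {Λ Λs : Submodule ℤ (EuclideanSpace ℝ (Fin L))}
    {c : ℝ} {U : EuclideanSpace ℝ (Fin L) ≃ₗᵢ[ℝ] EuclideanSpace ℝ (Fin L)} (hc : 0 < c)
    (h : (Λs : Set (EuclideanSpace ℝ (Fin L))) = (fun x => c • U x) '' Λ)
    {p : EuclideanSpace ℝ (Fin L)} (hp : p ∈ Λs) (r : ℝ) :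
    tupleCount K Λs p r = tupleCount K Λ 0 (r / c) := by
  let f : (Fin K → EuclideanSpace ℝ (Fin L)) → (Fin K → EuclideanSpace ℝ (Fin L)) :=
    fun t i => c • U (t i) + p
  have hf : Function.Injective f := by
    intro t t' htt
    ext1 i
    have := congrFun htt i
    simpa [f, hc.ne'] using this
  have hmem (x : EuclideanSpace ℝ (Fin L)) : c • U x ∈ Λs ↔ x ∈ Λ := by
    rw [← SetLike.mem_coe, h]
    exact ((smul_right_injective _ hc.ne').comp U.injective).mem_set_image
  have hn (x y : EuclideanSpace ℝ (Fin L)) :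
      ‖(c • U x + p) - (c • U y + p)‖ ≤ r ↔ ‖x - y‖ ≤ r / c := by
    rw [add_sub_add_right_eq_sub, ← smul_sub, ← map_sub, norm_smul, U.norm_map,
      Real.norm_of_nonneg hc.le, le_div_iff₀' hc]
  refine Eq.trans ?_ (Set.ncard_image_of_injective _ hf)
  rw [tupleCount]
  congr 1
  ext t
  simp only [Set.mem_ofPred_eq, Set.mem_image]
  constructor
  · rintro ⟨h0, hl, hd⟩
    have ht (i) : c • U (U.symm (c⁻¹ • (t i - p))) + p = t i := by
      simp [smul_smul, hc.ne']
    refine ⟨fun i => U.symm (c⁻¹ • (t i - p)), ⟨by simp [h0], fun i => ?_, fun i j => ?_⟩,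
      funext ht⟩
    · rw [← hmem, ← add_sub_cancel_right (c • U _) p, ht]
      exact Λs.sub_mem (hl i) hp
    · rw [← hn, ht, ht]
      exact hd i j
  · rintro ⟨t, ⟨h0, hl, hd⟩, rfl⟩
    exact ⟨by simp [f, h0], fun i => Λs.add_mem ((hmem _).2 (hl i)) hp,
      fun i j => (hn _ _).2 (hd i j)⟩

lemma covolume_of_similar {Λ Λs : Submodule ℤ (EuclideanSpace ℝ (Fin L))}
    [DiscreteTopology Λ] [IsZLattice ℝ Λ] [DiscreteTopology Λs] [IsZLattice ℝ Λs]
    {c : ℝ} {U : EuclideanSpace ℝ (Fin L) ≃ₗᵢ[ℝ] EuclideanSpace ℝ (Fin L)} (hc : 0 < c)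
    (h : (Λs : Set (EuclideanSpace ℝ (Fin L))) = (fun x => c • U x) '' Λ) :
    ZLattice.covolume Λs = c ^ L * ZLattice.covolume Λ := by
  let b := Free.chooseBasis ℤ Λ
  set B := b.ofZLatticeBasis ℝ Λ
  let e : EuclideanSpace ℝ (Fin L) ≃ₗ[ℝ] EuclideanSpace ℝ (Fin L) :=
    U.toLinearEquiv.trans (LinearEquiv.smulOfNeZero ℝ _ c hc.ne')
  have he : (e : EuclideanSpace ℝ (Fin L) → EuclideanSpace ℝ (Fin L)) = fun x => c • U x := rfl
  have hspan : Λs = Submodule.span ℤ (Set.range (B.map e)) := by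
    apply SetLike.coe_injective
    have h1 : Set.range (B.map e) = (e.toLinearMap.restrictScalars ℤ) '' Set.range B := by
      ext; simp
    rw [h1, Submodule.span_image, b.ofZLatticeBasis_span ℝ, h]
    rfl
  have hfd : IsAddFundamentalDomain Λs (ZSpan.fundamentalDomain (B.map e)) volume := by
    rw [hspan]
    exact ZSpan.isAddFundamentalDomain _ _
  have hU : volume (U '' ZSpan.fundamentalDomain B) = volume (ZSpan.fundamentalDomain B) := by
    rw [← U.symm.measurePreserving.measure_preimage
      (ZSpan.fundamentalDomain_measurableSet B).nullMeasurableSet]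
    exact congrArg volume (U.toEquiv.image_eq_preimage_symm _)
  rw [ZLattice.covolume_eq_measure_fundamentalDomain Λs volume hfd,
    ZLattice.covolume_eq_measure_fundamentalDomain Λ volume
      (ZLattice.isAddFundamentalDomain b volume), ← ZSpan.map_fundamentalDomain, he,
    ← Set.image_image (fun x => c • x) U, Set.image_smul, Measure.real,
    Measure.addHaar_smul_of_nonneg _ hc.le, finrank_euclideanSpace_fin, ENNReal.toReal_mul,
    ENNReal.toReal_ofReal (by positivity), hU]
  rfl

lemma lowerRadius_of_similar (hL : L ≠ 0) (K : ℕ) {Λ Λs : Submodule ℤ (EuclideanSpace ℝ (Fin L))}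
    [DiscreteTopology Λ] [IsZLattice ℝ Λ] [DiscreteTopology Λs] [IsZLattice ℝ Λs]
    {c : ℝ} {U : EuclideanSpace ℝ (Fin L) ≃ₗᵢ[ℝ] EuclideanSpace ℝ (Fin L)} (hc : 0 < c)
    (h : (Λs : Set (EuclideanSpace ℝ (Fin L))) = (fun x => c • U x) '' Λ) (N : ℕ) :
    lowerRadius K Λs N = c * lowerRadius K Λ N := by
  have h1 := ZLattice.covolume_pos Λ volume
  have h2 := omega_pos L
  rw [lowerRadius, lowerRadius, covolume_of_similar hc h, mul_assoc, mul_div_assoc,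
    Real.mul_rpow (by positivity) (by positivity), one_div (L : ℝ),
    Real.pow_rpow_inv_natCast hc.le hL]

lemma isTupleRadius_of_similar (K : ℕ) [NeZero K] {Λ Λs : Submodule ℤ (EuclideanSpace ℝ (Fin L))}
    {c : ℝ} {U : EuclideanSpace ℝ (Fin L) ≃ₗᵢ[ℝ] EuclideanSpace ℝ (Fin L)} (hc : 0 < c)
    (h : (Λs : Set (EuclideanSpace ℝ (Fin L))) = (fun x => c • U x) '' Λ)
    {p : EuclideanSpace ℝ (Fin L)} (hp : p ∈ Λs) (N : ℕ) (r : ℝ) :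
    IsTupleRadius K Λs p N r ↔ IsTupleRadius K Λ 0 N (r / c) := by
  simp only [IsTupleRadius, tupleCount_of_similar K hc h hp]
  refine and_congr_right fun _ => ⟨fun H r' hr' => ?_, fun H r' hr' => H _ (by gcongr)⟩
  simpa [hc.ne'] using H (r' * c) ((lt_div_iff₀ hc).1 hr')

/-! ### Existence of tuple radii -/

lemma finite_tuples (K : ℕ) [NeZero K] (Λ : Submodule ℤ (EuclideanSpace ℝ (Fin L)))
    [DiscreteTopology Λ] (r : ℝ) :
    {t : Fin K → EuclideanSpace ℝ (Fin L) |
      t 0 = 0 ∧ (∀ i, t i ∈ Λ) ∧ ∀ i j, ‖t i - t j‖ ≤ r}.Finite := by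
  have h : ((Metric.closedBall (0 : EuclideanSpace ℝ (Fin L)) r) ∩ Λ).Finite := by
    have : DiscreteTopology Λ.toAddSubgroup := ‹DiscreteTopology Λ›
    exact Metric.finite_isBounded_inter_isClosed DiscreteTopology.isDiscrete Metric.isBounded_closedBall
      (AddSubgroup.isClosed_of_discrete (H := Λ.toAddSubgroup))
  refine (Set.Finite.pi' fun _ : Fin K => h).subset ?_
  rintro t ⟨h0, hl, hd⟩ i
  have := hd i 0
  rw [h0, sub_zero] at this
  exact ⟨by simpa using this, hl i⟩

lemma tupleCount_mono (K : ℕ) [NeZero K] (Λ : Submodule ℤ (EuclideanSpace ℝ (Fin L)))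
    [DiscreteTopology Λ] : Monotone (tupleCount K Λ 0) := fun _ s hrs =>
  Set.ncard_le_ncard (fun _ ht => ⟨ht.1, ht.2.1, fun i j => (ht.2.2 i j).trans hrs⟩)
    (finite_tuples K Λ s)

/-- Right continuity of the count: only finitely many tuples have diameter at most `r₀ + 1`, so
distances exceeding `r₀` among them stay away from `r₀`. -/
lemma tupleCount_eventually_le (K : ℕ) [NeZero K] (Λ : Submodule ℤ (EuclideanSpace ℝ (Fin L)))
    [DiscreteTopology Λ] (r₀ : ℝ) : ∀ᶠ r in 𝓝[>] r₀, tupleCount K Λ 0 r ≤ tupleCount K Λ 0 r₀ := by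
  have hfin := finite_tuples K Λ (r₀ + 1)
  have h1 : ∀ᶠ r in 𝓝[>] r₀, ∀ t ∈ {t : Fin K → EuclideanSpace ℝ (Fin L) |
      t 0 = 0 ∧ (∀ i, t i ∈ Λ) ∧ ∀ i j, ‖t i - t j‖ ≤ r₀ + 1}, ∀ i j,
      ‖t i - t j‖ ≤ r → ‖t i - t j‖ ≤ r₀ := by
    simp only [hfin.eventually_all, eventually_all]
    intro t _ i j
    rcases le_or_gt ‖t i - t j‖ r₀ with h | h
    · exact Eventually.of_forall fun _ _ => h
    · filter_upwards [Ioo_mem_nhdsGT h] with r hr hle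
      exact absurd hle (not_le.2 hr.2)
  filter_upwards [h1, Ioo_mem_nhdsGT (lt_add_one r₀)] with r hr hr1
  refine Set.ncard_le_ncard (fun t ht => ⟨ht.1, ht.2.1, fun i j => ?_⟩) (finite_tuples K Λ r₀)
  exact hr t ⟨ht.1, ht.2.1, fun i j => (ht.2.2 i j).trans hr1.2.le⟩ i j (ht.2.2 i j)

lemma tupleCount_of_neg (K : ℕ) [NeZero K] (Λ : Submodule ℤ (EuclideanSpace ℝ (Fin L)))
    {r : ℝ} (hr : r < 0) : tupleCount K Λ 0 r = 0 := by
  have h : {t : Fin K → EuclideanSpace ℝ (Fin L) |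
      t 0 = 0 ∧ (∀ i, t i ∈ Λ) ∧ ∀ i j, ‖t i - t j‖ ≤ r} = ∅ :=
    Set.eq_empty_of_forall_notMem fun t ht => by
      linarith [ht.2.2 0 0, norm_nonneg (t 0 - t 0)]
  rw [tupleCount, h, Set.ncard_empty]

/-- The infimum of the radii with at least `N` tuples works: right continuity shows that it is
attained. -/
lemma exists_isTupleRadius (K : ℕ) [NeZero K] (Λ : Submodule ℤ (EuclideanSpace ℝ (Fin L)))
    [DiscreteTopology Λ] {N : ℕ} (hN : 0 < N) (h : ∃ r, N ≤ tupleCount K Λ 0 r) :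
    ∃ r, IsTupleRadius K Λ 0 N r := by
  set S := {r | N ≤ tupleCount K Λ 0 r}
  have hbdd : BddBelow S := ⟨0, fun r hr => not_lt.1 fun h0 => by
    have : N ≤ tupleCount K Λ 0 r := hr
    rw [tupleCount_of_neg K Λ h0] at this
    omega⟩
  refine ⟨sInf S, ?_, fun r' hr' => ?_⟩
  · obtain ⟨r, hr, hr0⟩ := ((tupleCount_eventually_le K Λ (sInf S)).and
      self_mem_nhdsWithin).exists
    obtain ⟨s, hs, hsr⟩ := exists_lt_of_csInf_lt h (Set.mem_Ioi.1 hr0)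
    exact (le_trans hs (tupleCount_mono K Λ hsr.le)).trans hr
  · exact (not_le.1 fun h' => notMem_of_lt_csInf hr' hbdd h').le

lemma tendsto_tupleCount_atTop (hL : L ≠ 0) (Λ : Submodule ℤ (EuclideanSpace ℝ (Fin L)))
    [DiscreteTopology Λ] [IsZLattice ℝ Λ] :
    Tendsto (fun r : ℝ => (tupleCount 3 Λ 0 r : ℝ)) atTop atTop := by
  have hκ : 0 < volume.real (admissiblePairs L) / ZLattice.covolume Λ ^ 2 :=
    div_pos (volume_admissiblePairs_pos L) (pow_pos (ZLattice.covolume_pos Λ) 2)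
  refine ((tendsto_tupleCount Λ).pos_mul_atTop hκ
    (tendsto_pow_atTop (n := 2 * L) (by omega))).congr' ?_
  filter_upwards [eventually_gt_atTop 0] with r hr
  exact div_mul_cancel₀ _ (pow_pos hr _).ne'

/-! ### Asymptotics of tuple radii -/

lemma isTupleRadius_density (Λ : Submodule ℤ (EuclideanSpace ℝ (Fin L)))
    [DiscreteTopology Λ] [IsZLattice ℝ Λ] {δ : ℝ} (hδ : 0 < δ) :
    ∃ N₀ : ℕ, ∀ N ≥ N₀, 0 < N ∧ ∀ r, IsTupleRadius 3 Λ 0 N r → 0 < r ∧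
      |(N : ℝ) / r ^ (2 * L) - volume.real (admissiblePairs L) / ZLattice.covolume Λ ^ 2| ≤ δ := by
  set κ := volume.real (admissiblePairs L) / ZLattice.covolume Λ ^ 2
  obtain ⟨R, hR⟩ := eventually_atTop.1 (((tendsto_tupleCount Λ).eventually
    (Metric.closedBall_mem_nhds κ hδ)).and (eventually_gt_atTop 0))
  -- More tuples than are available at `R` force `r > R`, where the asymptotic bounds hold.
  refine ⟨tupleCount 3 Λ 0 R + 1, fun N hN => ⟨by omega, fun r hr => ?_⟩⟩
  have hRr : R < r := by
    by_contra! h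
    have := tupleCount_mono 3 Λ h
    have := hr.1
    omega
  have hr0 : 0 < r := (hR R le_rfl).2.trans hRr
  refine ⟨hr0, ?_⟩
  have hpow : 0 < r ^ (2 * L) := by positivity
  have hbound (s : ℝ) (hs : R ≤ s) : (κ - δ) * s ^ (2 * L) ≤ tupleCount 3 Λ 0 s ∧
      (tupleCount 3 Λ 0 s : ℝ) ≤ (κ + δ) * s ^ (2 * L) := by
    obtain ⟨h1, h2⟩ := hR s hs
    rw [Real.dist_eq, abs_sub_le_iff] at h1
    rw [← le_div_iff₀ (by positivity), ← div_le_iff₀ (by positivity)]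
    exact ⟨by linarith, by linarith⟩
  have hupper : (N : ℝ) ≤ (κ + δ) * r ^ (2 * L) :=
    (Nat.cast_le.2 hr.1).trans (hbound r hRr.le).2
  -- The count at `r` may exceed `N`, so the lower bound uses radii `s < r`, where the count is at
  -- most `N`, and lets `s` tend to `r`.
  have hlower : (κ - δ) * r ^ (2 * L) ≤ N := by
    have hc : Tendsto (fun s : ℝ => (κ - δ) * s ^ (2 * L)) (𝓝[<] r)
        (𝓝 ((κ - δ) * r ^ (2 * L))) :=
      (Continuous.tendsto (by fun_prop) r).mono_left nhdsWithin_le_nhds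
    refine le_of_tendsto hc ?_
    filter_upwards [Ioo_mem_nhdsLT hRr] with s hs
    exact (hbound s hs.1.le).1.trans (Nat.cast_le.2 (hr.2 s hs.2))
  rw [abs_sub_le_iff, sub_le_iff_le_add', sub_le_comm]
  exact ⟨(div_le_iff₀ hpow).2 hupper, (le_div_iff₀ hpow).2 hlower⟩

/-- The ratio depends on `N` and `r` only through `N / r ^ (2L)`, so convergence of that density
transfers by continuity. -/
lemma div_lowerRadius_eq (hL : L ≠ 0) (Λ : Submodule ℤ (EuclideanSpace ℝ (Fin L)))
    [DiscreteTopology Λ] [IsZLattice ℝ Λ] {N : ℕ} (hN : 0 < N) {r : ℝ} (hr : 0 < r) :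
    r / lowerRadius 3 Λ N =
      (omega L ^ 2 / ZLattice.covolume Λ ^ 2 / (N / r ^ (2 * L))) ^ (1 / (2 * (L : ℝ))) := by
  have hν := ZLattice.covolume_pos Λ volume
  have hω := omega_pos L
  have hN' : (0 : ℝ) < N := by exact_mod_cast hN
  have hL' : (L : ℝ) ≠ 0 := by exact_mod_cast hL
  have h1 : r = (r ^ (2 * L)) ^ (1 / (2 * (L : ℝ))) := by
    rw [one_div, show 2 * (L : ℝ) = ((2 * L : ℕ) : ℝ) by push_cast; rfl,
      Real.pow_rpow_inv_natCast hr.le (by omega)]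
  have h2 : lowerRadius 3 Λ N =
      (ZLattice.covolume Λ ^ 2 * N / omega L ^ 2) ^ (1 / (2 * (L : ℝ))) := by
    have h3 : ZLattice.covolume Λ ^ 2 * N / omega L ^ 2 =
        (ZLattice.covolume Λ * (N : ℝ) ^ (1 / (((3 : ℕ) : ℝ) - 1)) / omega L) ^ (2 : ℝ) := by
      rw [show (1 : ℝ) / (((3 : ℕ) : ℝ) - 1) = 1 / 2 by norm_num, ← Real.sqrt_eq_rpow,
        Real.rpow_two, div_pow, mul_pow, Real.sq_sqrt hN'.le]
    rw [lowerRadius, h3, ← Real.rpow_mul (by positivity)]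
    congr 1
    field_simp
  conv_lhs => rw [h1, h2, ← Real.div_rpow (by positivity) (by positivity)]
  congr 1
  field_simp

theorem isExpansionFactor_three (hL : L ≠ 0) :
    IsExpansionFactor 3 L
      ((omega L ^ 2 / volume.real (admissiblePairs L)) ^ (1 / (2 * (L : ℝ)))) := by
  intro Λ _ _ ε hε
  have hν := ZLattice.covolume_pos Λ volume
  have hω := omega_pos L
  have hV := volume_admissiblePairs_pos L
  set κ := volume.real (admissiblePairs L) / ZLattice.covolume Λ ^ 2 with hκ
  have hκ0 : 0 < κ := by positivity
  have hval : omega L ^ 2 / volume.real (admissiblePairs L) =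
      omega L ^ 2 / ZLattice.covolume Λ ^ 2 / κ := by
    rw [hκ]
    field_simp
  have hcont : ContinuousAt
      (fun y => (omega L ^ 2 / ZLattice.covolume Λ ^ 2 / y) ^ (1 / (2 * (L : ℝ)))) κ :=
    (continuousAt_const.div continuousAt_id hκ0.ne').rpow_const (Or.inr (by positivity))
  obtain ⟨δ, hδ, hclose⟩ := Metric.continuousAt_iff.1 hcont ε hε
  obtain ⟨N₀, hN₀⟩ := isTupleRadius_density Λ (half_pos hδ)
  refine ⟨N₀, fun N hN Λs _ _ ⟨c, U, hc, hΛs⟩ p hp => ?_⟩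
  obtain ⟨hNpos, hrad⟩ := hN₀ N hN
  simp only [isTupleRadius_of_similar 3 hc hΛs hp]
  constructor
  · obtain ⟨R, hR⟩ := ((tendsto_tupleCount_atTop hL Λ).eventually_ge_atTop (N : ℝ)).exists
    obtain ⟨r, hr⟩ := exists_isTupleRadius 3 Λ hNpos ⟨R, Nat.cast_le.1 hR⟩
    exact ⟨r * c, by rwa [mul_div_cancel_right₀ _ hc.ne']⟩
  · intro r hr
    obtain ⟨hr0, hd⟩ := hrad _ hr
    rw [lowerRadius_of_similar hL 3 hc hΛs, ← div_div, div_lowerRadius_eq hL Λ hNpos hr0, hval]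
    refine hclose ?_
    rw [Real.dist_eq]
    linarith

/-! ### Uniqueness and the closed form -/

/-- Testing on the integer lattice suffices; the required existence of radii keeps the limit
condition from being vacuous. -/
lemma IsExpansionFactor.unique {K : ℕ} [NeZero K] {ψ ψ' : ℝ} (h : IsExpansionFactor K L ψ)
    (h' : IsExpansionFactor K L ψ') : ψ = ψ' := by
  let B := (EuclideanSpace.basisFun (Fin L) ℝ).toBasis
  let Λ := Submodule.span ℤ (Set.range B)
  refine eq_of_forall_dist_le fun ε hε => ?_
  obtain ⟨N₁, h₁⟩ := h Λ (ε / 2) (half_pos hε)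
  obtain ⟨N₂, h₂⟩ := h' Λ (ε / 2) (half_pos hε)
  have hsim : GeometricallySimilar Λ Λ := ⟨1, LinearIsometryEquiv.refl ℝ _, one_pos, by simp⟩
  obtain ⟨⟨r, hr⟩, h₁⟩ := h₁ (max N₁ N₂) (le_max_left _ _) Λ hsim 0 Λ.zero_mem
  have h₂ := (h₂ (max N₁ N₂) (le_max_right _ _) Λ hsim 0 Λ.zero_mem).2 r hr
  have h₁ := h₁ r hr
  rw [abs_sub_comm] at h₁
  rw [Real.dist_eq]
  have := abs_sub_le ψ (r / lowerRadius K Λ (max N₁ N₂)) ψ'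
  linarith

theorem expansionFactor_eq (hL : Odd L) :
    (omega L ^ 2 / volume.real (admissiblePairs L)) ^ (1 / (2 * (L : ℝ))) =
      (omega L / omega (L - 1)) ^ (1 / (2 * (L : ℝ))) *
        (((L : ℝ) + 1) / (2 * (L : ℝ))) ^ (1 / (2 * (L : ℝ))) *
        beta L ^ (-(1 / (2 * (L : ℝ)))) := by
  obtain ⟨m, rfl⟩ := hL
  have hV := volume_admissiblePairs_pos (2 * m + 1)
  rw [volume_admissiblePairs_eq_beta] at hV ⊢
  have h1 := omega_pos (2 * m + 1)
  have h2 := omega_pos (2 * m)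
  -- The alternating sum is not visibly positive; its sign is read off from the volume.
  have hβ : 0 < beta (2 * m + 1) := pos_of_mul_pos_right hV (by positivity)
  rw [add_tsub_cancel_right, Real.rpow_neg hβ.le, ← Real.inv_rpow hβ.le,
    ← Real.mul_rpow (by positivity) (by positivity), ← Real.mul_rpow (by positivity) (by positivity)]
  congr 1
  push_cast
  field_simp
  ring

end MDLattice

theorem theorem5p2 (L : ℕ) (hL : Odd L) (ψ : ℝ) :
    MDLattice.IsExpansionFactor 3 L ψ ↔
      ψ = (MDLattice.omega L / MDLattice.omega (L - 1)) ^ (1 / (2 * (L : ℝ))) *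
        (((L : ℝ) + 1) / (2 * (L : ℝ))) ^ (1 / (2 * (L : ℝ))) *
        MDLattice.beta L ^ (-(1 / (2 * (L : ℝ)))) := by
  have h := MDLattice.isExpansionFactor_three hL.pos.ne'
  rw [MDLattice.expansionFactor_eq hL] at h
  exact ⟨fun hψ => hψ.unique h, fun hψ => hψ ▸ h⟩
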